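/- Rings are associative with $1$, not necessarily commutative. For a module $M$, $\mathrm{soc}(M)$ is the sum of its simple submodules and $\mathrm{top}(M)=M/\mathrm{rad}(M)$, where $\mathrm{rad}(M)$ is the intersection of its maximal submodules. For a ring $R$ put $S_r=\mathrm{soc}(R_R)$ and $S_l=\mathrm{soc}({}_RR)$; $S_r$ is essential if it meets every nonzero right ideal nontrivially. An idempotent $e\in R$ is local if $eRe\cong \mathrm{End}_R(eR)$ is a local ring, and $R$ is semiperfect if $1$ is a sum of finitely many pairwise orthogonal local idempotents $f_1,\dots,f_m$. A basic set of idempotents is a subset $\{e_1,\dots,e_n\}$ of such a set $\{f_1,\dots,f_m\}$ such that each right ideal $f_iR$ is isomorphic to exactly one of $e_1R,\dots,e_nR$. A semiperfect ring $R$ is - QF-2 if $\mathrm{soc}(eR)$ and $\mathrm{soc}(Re)$ are simple for every local idempotent $e\in R$; - Kasch if every simple right (left) $R$-module is isomorphic to a right (left) ideal of $R$; - a ring with a Nakayama permutation if, for a basic set of idempotents $e_1,\dots,e_n$, there is a permutation $\pi$ of $\{1,\dots,n\}$ such that $\mathrm{soc}(e_kR)\cong\mathrm{top}(e_{\pi(k)}R)$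 as right modules and $\mathrm{soc}(Re_{\pi(k)})\cong\mathrm{top}(Re_k)$ as left modules for all $k$. **Theorem.** Let $R$ be a semiperfect QF-2 Kasch ring with an essential right socle. Then $S_l=S_r$ and $R$ has a Nakayama permutation (with respect to every basic set of idempotents). In particular, any semiperfect ring with a Nakayama permutation and an essential right socle satisfies $S_l=S_r$. -/

import Mathlib

/-!
Right modules over `R` are modules over `Rᵐᵒᵖ`; in particular `R` as a right module over itself is
`R` with its `Rᵐᵒᵖ`-module structure, and right ideals are the submodules `Submodule Rᵐᵒᵖ R`.
-/

open scoped MulOpposite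

section ModuleNotions

variable (A M : Type*) [Ring A] [AddCommGroup M] [Module A M]

/-- The socle of a module: the sum of its simple submodules. -/
def moduleSocle : Submodule A M := sSup {N : Submodule A M | IsSimpleModule A N}

/-- The top of a module: the quotient by its radical (the intersection of the maximal
submodules). -/
abbrev ModuleTop : Type _ := M ⧸ Module.jacobson A M

end ModuleNotions

section RingNotions

variable {R : Type*} [Ring R]

/-- The principal right ideal `aR`. -/
abbrev rightPrincipal (a : R) : Submodule Rᵐᵒᵖ R := Submodule.span Rᵐᵒᵖ {a}

/-- The principal left ideal `Ra`. -/
abbrev leftPrincipal (a : R) : Submodule R R := Submodule.span R {a}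

/-- An idempotent `e` is local if the corner ring `eRe`, which is the endomorphism ring of `eR`,
is a local ring (in particular nonzero). -/
def IsLocalIdempotent (e : R) : Prop :=
  ∃ he : IsIdempotentElem e, IsLocalRing he.Corner

/-- A complete set of pairwise orthogonal local idempotents. -/
structure IsLocalDecomposition {m : ℕ} (f : Fin m → R) : Prop where
  complete : CompleteOrthogonalIdempotents f
  isLocal : ∀ i, IsLocalIdempotent (f i)

/-- A basic set of idempotents: a subset `e₁, …, eₙ` of a complete set `f₁, …, fₘ` of pairwise
orthogonal local idempotents such that each `fᵢR` is isomorphic, as a right module, to exactly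
one of `e₁R, …, eₙR`. -/
def IsBasicSet {n : ℕ} (e : Fin n → R) : Prop :=
  ∃ (m : ℕ) (f : Fin m → R) (ι : Fin n ↪ Fin m), IsLocalDecomposition f ∧
    (∀ k, e k = f (ι k)) ∧
    ∀ i, ∃! k, Nonempty (rightPrincipal (f i) ≃ₗ[Rᵐᵒᵖ] rightPrincipal (e k))

/-- `π` is a Nakayama permutation with respect to `e₁, …, eₙ`. -/
structure IsNakayamaPermutation {n : ℕ} (e : Fin n → R) (π : Equiv.Perm (Fin n)) : Prop where
  /-- `soc(eₖR) ≅ top(e_{π(k)}R)` as right modules -/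
  right : ∀ k, Nonempty (moduleSocle Rᵐᵒᵖ (rightPrincipal (e k)) ≃ₗ[Rᵐᵒᵖ]
    ModuleTop Rᵐᵒᵖ (rightPrincipal (e (π k))))
  /-- `soc(Re_{π(k)}) ≅ top(Reₖ)` as left modules -/
  left : ∀ k, Nonempty (moduleSocle R (leftPrincipal (e (π k))) ≃ₗ[R]
    ModuleTop R (leftPrincipal (e k)))

end RingNotions

section RingProperties

universe u

variable (R : Type u) [Ring R]

/-- A ring is semiperfect if `1` is a finite sum of pairwise orthogonal local idempotents. -/
def IsSemiperfectRing : Prop := ∃ (m : ℕ) (f : Fin m → R), IsLocalDecomposition f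

/-- The right socle `soc(R_R)`. -/
def rightSocle : Submodule Rᵐᵒᵖ R := moduleSocle Rᵐᵒᵖ R

/-- The left socle `soc(_R R)`. -/
def leftSocle : Submodule R R := moduleSocle R R

/-- The left and the right socle are the same subset of `R`. -/
def SoclesCoincide : Prop := (leftSocle R : Set R) = (rightSocle R : Set R)

/-- The right socle meets every nonzero right ideal nontrivially. -/
def HasEssentialRightSocle : Prop :=
  ∀ I : Submodule Rᵐᵒᵖ R, I ≠ ⊥ → rightSocle R ⊓ I ≠ ⊥

/-- The socle of every primitive right ideal is simple. -/
def IsRightQF2 : Prop :=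
  ∀ e : R, IsLocalIdempotent e → IsSimpleModule Rᵐᵒᵖ (moduleSocle Rᵐᵒᵖ (rightPrincipal e))

/-- The socle of every primitive left ideal is simple. -/
def IsLeftQF2 : Prop :=
  ∀ e : R, IsLocalIdempotent e → IsSimpleModule R (moduleSocle R (leftPrincipal e))

/-- Every simple right module is isomorphic to a right ideal. Simple modules are quotients of `R`,
so those in the universe of `R` represent all of them. -/
def IsRightKasch : Prop :=
  ∀ (V : Type u) [AddCommGroup V] [Module Rᵐᵒᵖ V], IsSimpleModule Rᵐᵒᵖ V →
    ∃ I : Submodule Rᵐᵒᵖ R, Nonempty (V ≃ₗ[Rᵐᵒᵖ] I)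

/-- Every simple left module is isomorphic to a left ideal. -/
def IsLeftKasch : Prop :=
  ∀ (V : Type u) [AddCommGroup V] [Module R V], IsSimpleModule R V →
    ∃ I : Submodule R R, Nonempty (V ≃ₗ[R] I)

/-- `R` has a Nakayama permutation, with respect to some basic set of idempotents. -/
def HasNakayamaPermutation : Prop :=
  ∃ (n : ℕ) (e : Fin n → R) (π : Equiv.Perm (Fin n)), IsBasicSet e ∧ IsNakayamaPermutation e π

end RingProperties

/-! For a local idempotent `e`, a simple module on which `e` acts nontrivially is the top of the
projective module of `e`, so `e` is determined by it up to isomorphism. The Kasch conditions thus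
say that `e S_l` and `S_r e` are nonzero.

If `0 ≠ ex` with `x ∈ S_l`, essentiality gives a nonzero `z ∈ exR ∩ S_r`. Simplicity of `soc(eR) = e
S_r` gives `zR = e S_r`, and `z` lies in the two-sided ideal `S_l`; hence `e S_r ⊆ S_l`, and summing
over the idempotents `S_r ⊆ S_l`. Now `S_r e` is a nonzero left submodule of the simple module `S_l
e = soc(Re)`, so `S_l e = S_r e` and equality follows. A Nakayama permutation provides the same
simplicity and nonvanishing for a basic set, which suffices up to isomorphism of idempotents
(`soclesCoincide_of_representatives`).

Conversely, once the socles agree, a nonzero `x ∈ e_k S e_j` identifies both `soc(e_k R)` with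
`top(e_j R)` and `soc(R e_j)` with `top(R e_k)`. This makes `k ↦ j` injective, hence a permutation.
-/

/-! ### Local idempotents and their isomorphisms -/

section CornerLocal

/-- An elementwise, left-right symmetric form of locality of the idempotent `e`: every element of
`eAe` or its complement to `e` has a two-sided inverse in `eAe`. -/
def CornerLocal {A : Type*} [Ring A] (e : A) : Prop :=
  e ≠ 0 ∧ e * e = e ∧ ∀ x, e * x = x → x * e = x →
    (∃ y, y * x = e ∧ x * y = e) ∨ ∃ y, y * (e - x) = e ∧ (e - x) * y = e

/-- The idempotents `e` and `f` are isomorphic, i.e. they generate isomorphic one-sided ideals. -/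
def IdempotentsIso {A : Type*} [Ring A] (e f : A) : Prop :=
  ∃ a b, e * a = a ∧ a * f = a ∧ f * b = b ∧ b * e = b ∧ a * b = e ∧ b * a = f

theorem IsLocalIdempotent.cornerLocal {R : Type*} [Ring R] {e : R} (h : IsLocalIdempotent e) :
    CornerLocal e := by
  obtain ⟨he, hl⟩ := h
  have unit_inv : ∀ x : he.Corner, IsUnit x → ∃ y : R, y * x.1 = e ∧ x.1 * y = e := by
    rintro x ⟨u, rfl⟩
    exact ⟨(u⁻¹ : he.Cornerˣ).1.1, congrArg Subtype.val u.inv_mul, congrArg Subtype.val u.mul_inv⟩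
  refine ⟨fun h0 => ?_, he.eq, fun x h1 h2 => ?_⟩
  · exact one_ne_zero (α := he.Corner) (Subtype.ext h0)
  · let x' : he.Corner := ⟨x, (Subsemigroup.mem_corner_iff he).2 ⟨h1, h2⟩⟩
    rcases IsLocalRing.isUnit_or_isUnit_of_add_one (add_sub_cancel x' 1) with h | h
    · exact Or.inl (unit_inv x' h)
    · exact Or.inr (unit_inv (1 - x') h)

theorem CornerLocal.op {A : Type*} [Ring A] {e : A} (h : CornerLocal e) :
    CornerLocal (MulOpposite.op e) := by
  obtain ⟨h0, h1, h2⟩ := h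
  refine ⟨fun h => h0 (MulOpposite.op_injective h), by rw [← MulOpposite.op_mul, h1],
    fun x h3 h4 => ?_⟩
  rcases h2 x.unop (by rw [← MulOpposite.unop_op e, ← MulOpposite.unop_mul, h4])
    (by rw [← MulOpposite.unop_op e, ← MulOpposite.unop_mul, h3]) with ⟨y, h5, h6⟩ | ⟨y, h5, h6⟩
  · exact Or.inl ⟨.op y, MulOpposite.unop_injective h6, MulOpposite.unop_injective h5⟩
  · exact Or.inr ⟨.op y, MulOpposite.unop_injective h6, MulOpposite.unop_injective h5⟩

/-- Local idempotents that act nontrivially on the same simple module are isomorphic. -/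
theorem CornerLocal.idempotentsIso {A V : Type*} [Ring A] [AddCommGroup V] [Module A V]
    [IsSimpleModule A V] {e f : A} (he : CornerLocal e) (hf : CornerLocal f) {v w : V}
    (hv : v ≠ 0) (hw : w ≠ 0) (hev : e • v = v) (hfw : f • w = w) : IdempotentsIso e f := by
  obtain ⟨-, he1, he2⟩ := he
  obtain ⟨-, hf1, hf2⟩ := hf
  obtain ⟨r, hr⟩ := IsSimpleModule.toSpanSingleton_surjective A hw v
  obtain ⟨s, hs⟩ := IsSimpleModule.toSpanSingleton_surjective A hv w
  rw [LinearMap.toSpanSingleton_apply] at hr hs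
  have hxv : (e * r * f * (f * s * e)) • v = v := by
    simp only [mul_smul, hev, hs, hfw, hr]
  obtain ⟨y, -, hy⟩ : ∃ y, y * (e * r * f * (f * s * e)) = e ∧
      (e * r * f * (f * s * e)) * y = e := by
    -- The element fixes `v`, so its complement in `e` kills `v = e • v` and cannot be invertible.
    refine (he2 _ (by simp only [← mul_assoc, he1]) (by simp only [mul_assoc, he1])).resolve_right
      fun ⟨y, hy, _⟩ => hv ?_
    rw [← hev, ← hy, mul_smul, sub_smul, hev, hxv, sub_self, smul_zero]
  set a := e * r * f with ha
  set b := f * s * e * y * e with hb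
  have hea : e * a = a := by simp only [ha, ← mul_assoc, he1]
  have haf : a * f = a := by simp only [ha, mul_assoc, hf1]
  have hfb : f * b = b := by simp only [hb, ← mul_assoc, hf1]
  have hbe : b * e = b := by simp only [hb, mul_assoc, he1]
  have hab : a * b = e := by
    calc a * b = a * (f * s * e) * y * e := by simp only [hb, mul_assoc]
      _ = e := by rw [hy, he1]
  refine ⟨a, b, hea, haf, hfb, hbe, hab, ?_⟩
  have hg : b * a * (b * a) = b * a := by
    rw [mul_assoc, ← mul_assoc a b a, hab, hea]
  have hfg : f * (b * a) = b * a := by rw [← mul_assoc, hfb]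
  have hgf : b * a * f = b * a := by rw [mul_assoc, haf]
  -- `b * a` is an idempotent of the local corner of `f`, hence `f` or `0`; the value `0` would
  -- force `e = 0`.
  rcases hf2 (b * a) hfg hgf with ⟨z, hz, -⟩ | ⟨z, hz, -⟩
  · rw [← hfg, ← hz, mul_assoc, hg]
  · have h0 : b * a = 0 := by
      rw [← hfg, ← hz, mul_assoc, sub_mul, hfg, hg, sub_self, mul_zero]
    have he0 : e = 0 := by
      rw [← he1, ← hab, mul_assoc, ← mul_assoc b, h0, zero_mul, mul_zero]
    exact absurd (by rw [← hev, he0, zero_smul]) hv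

end CornerLocal

/-! ### Projective modules of local idempotents and their tops -/

section LocalModules

variable {A P V : Type*} [Ring A] [AddCommGroup P] [Module A P] [AddCommGroup V] [Module A V]

/-- `p` generates `P`, and `a ↦ a • p` induces an isomorphism `Ae ≅ P`. -/
structure IsIdempotentGenerator (e : A) (p : P) : Prop where
  smul_self : e • p = p
  span_eq_top : Submodule.span A {p} = ⊤
  mul_eq_zero : ∀ a : A, a • p = 0 → a * e = 0

theorem IsIdempotentGenerator.exists_linearMap {e : A} {p : P} (h : IsIdempotentGenerator e p)
    {v : V} (hv : e • v = v) : ∃ φ : P →ₗ[A] V, φ p = v := by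
  have hsurj : Function.Surjective (LinearMap.toSpanSingleton A P p) := by
    rw [← LinearMap.range_eq_top, LinearMap.range_toSpanSingleton, h.span_eq_top]
  let ψ := (LinearMap.ker (LinearMap.toSpanSingleton A P p)).liftQ
    (LinearMap.toSpanSingleton A V v) (fun a ha => by
      rw [LinearMap.mem_ker, LinearMap.toSpanSingleton_apply] at ha ⊢
      rw [← hv, ← mul_smul, h.mul_eq_zero a ha, zero_smul])
  let E := (LinearMap.toSpanSingleton A P p).quotKerEquivOfSurjective hsurj
  refine ⟨ψ ∘ₗ E.symm.toLinearMap, ?_⟩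
  have : E.symm p = Submodule.Quotient.mk 1 := by
    rw [LinearEquiv.symm_apply_eq]
    exact (one_smul A p).symm
  simp [this, ψ]

theorem IsIdempotentGenerator.ne_zero {e : A} {p : P} (h : IsIdempotentGenerator e p)
    (he : CornerLocal e) : p ≠ 0 := fun h0 =>
  he.1 (by simpa using h.mul_eq_zero 1 (by simp [h0]))

/-- Two distinct maximal submodules would split `p` as `a • p + (1 - a) • p`. Compressing by `e`,
one of `e * a * e` and `e - e * a * e` is invertible in the corner, which puts `p` into a proper
submodule. -/
theorem IsIdempotentGenerator.eq_of_isCoatom {e : A} {p : P} (h : IsIdempotentGenerator e p)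
    (he : CornerLocal e) {N N' : Submodule A P} (hN : IsCoatom N) (hN' : IsCoatom N') :
    N = N' := by
  obtain ⟨-, he1, he2⟩ := he
  have top_of_mem : ∀ {K : Submodule A P}, p ∈ K → K = ⊤ := fun hp =>
    top_unique (h.span_eq_top ▸ (Submodule.span_singleton_le_iff_mem _ _).2 hp)
  by_contra hne
  have hp : p ∈ N ⊔ N' := by rw [hN.sup_eq_top_of_ne hN' hne]; trivial
  obtain ⟨x, hx, x', hx', hsum⟩ := Submodule.mem_sup.1 hp
  obtain ⟨a, rfl⟩ := Submodule.mem_span_singleton.1 (h.span_eq_top ▸ Submodule.mem_top : x ∈ _)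
  have hx'p : x' = (1 - a) • p := by
    rw [sub_smul, one_smul, eq_sub_iff_add_eq', hsum]
  have key : (e * a * e) • p ∈ N := by
    rw [mul_smul, h.smul_self, mul_smul]; exact N.smul_mem _ hx
  have key' : (e - e * a * e) • p ∈ N' := by
    have : e - e * a * e = e * (1 - a) * e := by rw [mul_sub, mul_one, sub_mul, he1]
    rw [this, mul_smul, h.smul_self, mul_smul, ← hx'p]; exact N'.smul_mem _ hx'
  rcases he2 (e * a * e) (by simp only [← mul_assoc, he1]) (by simp only [mul_assoc, he1])
    with ⟨y, hy, -⟩ | ⟨y, hy, -⟩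
  · refine hN.1 (top_of_mem ?_)
    rw [← h.smul_self, ← hy, mul_smul]; exact N.smul_mem _ key
  · refine hN'.1 (top_of_mem ?_)
    rw [← h.smul_self, ← hy, mul_smul]; exact N'.smul_mem _ key'

theorem IsIdempotentGenerator.isCoatom_jacobson {e : A} {p : P} (h : IsIdempotentGenerator e p)
    (he : CornerLocal e) : IsCoatom (Module.jacobson A P) := by
  have : Module.Finite A P := ⟨⟨{p}, by simpa using h.span_eq_top⟩⟩
  obtain h' | ⟨N, hN, -⟩ := eq_top_or_exists_le_coatom (⊥ : Submodule A P)
  · have hp : p ∈ (⊥ : Submodule A P) := h' ▸ Submodule.mem_top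
    exact absurd ((Submodule.mem_bot A).1 hp) (h.ne_zero he)
  · have : {m : Submodule A P | IsCoatom m} = {N} := by
      ext m
      exact ⟨fun hm => h.eq_of_isCoatom he hm hN, fun hm => by rw [hm]; exact hN⟩
    rw [Module.jacobson, this, sInf_singleton]
    exact hN

theorem IsIdempotentGenerator.isSimpleModule_top {e : A} {p : P}
    (h : IsIdempotentGenerator e p) (he : CornerLocal e) : IsSimpleModule A (ModuleTop A P) :=
  isSimpleModule_iff_isCoatom.2 (h.isCoatom_jacobson he)

theorem IsIdempotentGenerator.exists_top {e : A} {p : P} (h : IsIdempotentGenerator e p)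
    (he : CornerLocal e) : ∃ v : ModuleTop A P, v ≠ 0 ∧ e • v = v := by
  refine ⟨Submodule.Quotient.mk p, fun h0 => (h.isCoatom_jacobson he).1 ?_, ?_⟩
  · rw [Submodule.Quotient.mk_eq_zero] at h0
    exact top_unique (h.span_eq_top ▸ (Submodule.span_singleton_le_iff_mem _ _).2 h0)
  · rw [← Submodule.Quotient.mk_smul, h.smul_self]

/-- A simple module on which a local idempotent acts nontrivially is the corresponding top. -/
theorem IsIdempotentGenerator.nonempty_equiv_top {e : A} {p : P}
    (h : IsIdempotentGenerator e p) (he : CornerLocal e) [IsSimpleModule A V] {v : V}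
    (hv : v ≠ 0) (hev : e • v = v) : Nonempty (V ≃ₗ[A] ModuleTop A P) := by
  obtain ⟨φ, hφ⟩ := h.exists_linearMap hev
  have hsurj : Function.Surjective φ :=
    LinearMap.surjective_of_ne_zero fun h0 => hv (by rw [← hφ, h0, LinearMap.zero_apply])
  have hker : LinearMap.ker φ = Module.jacobson A P :=
    h.eq_of_isCoatom he (LinearMap.isCoatom_ker_of_surjective hsurj) (h.isCoatom_jacobson he)
  exact ⟨((Submodule.quotEquivOfEq _ _ hker).symm.trans
    (φ.quotKerEquivOfSurjective hsurj)).symm⟩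

end LocalModules

/-! ### Functoriality of the socle -/

section Socle

variable {A M N : Type*} [Ring A] [AddCommGroup M] [Module A M] [AddCommGroup N] [Module A N]

theorem le_moduleSocle (S : Submodule A M) [h : IsSimpleModule A S] : S ≤ moduleSocle A M :=
  le_sSup h

/-- The image of a simple submodule is simple or zero. Applied to multiplications, this makes both
socles of a ring two-sided ideals. -/
theorem map_mem_moduleSocle (φ : M →ₗ[A] N) {x : M} (hx : x ∈ moduleSocle A M) :
    φ x ∈ moduleSocle A N := by
  suffices h : moduleSocle A M ≤ (moduleSocle A N).comap φ from h hx
  refine sSup_le fun S (hS : IsSimpleModule A S) => ?_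
  rw [← Submodule.map_le_iff_le_comap]
  rcases LinearMap.injective_or_eq_zero (φ ∘ₗ S.subtype) with h | h
  · have : IsSimpleModule A (S.map φ) := by
      have hr : S.map φ = LinearMap.range (φ ∘ₗ S.subtype) := by
        rw [LinearMap.range_comp, Submodule.range_subtype]
      rw [hr]
      exact IsSimpleModule.congr (LinearEquiv.ofInjective _ h).symm
    exact le_moduleSocle _
  · rintro _ ⟨x, hx, rfl⟩
    have : φ x = 0 := LinearMap.congr_fun h ⟨x, hx⟩
    rw [this]; exact zero_mem _

theorem mem_moduleSocle_of_equiv_simple [IsSimpleModule A M] {S : Submodule A N} (E : M ≃ₗ[A] S)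
    (x : M) : (E x : N) ∈ moduleSocle A N := by
  have : IsSimpleModule A S := IsSimpleModule.congr E.symm
  exact le_moduleSocle S (E x).2

end Socle

/-! ### Principal one-sided ideals and their socles -/

section PrincipalIdeals

variable {R : Type*} [Ring R] {e f : R}

theorem mem_rightPrincipal (he : e * e = e) {x : R} : x ∈ rightPrincipal e ↔ e * x = x := by
  rw [Submodule.mem_span_singleton]
  constructor
  · rintro ⟨a, rfl⟩
    rw [MulOpposite.smul_eq_mul_unop, ← mul_assoc, he]
  · intro h
    exact ⟨.op x, h⟩

theorem mem_leftPrincipal (he : e * e = e) {x : R} : x ∈ leftPrincipal e ↔ x * e = x := by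
  rw [Submodule.mem_span_singleton]
  constructor
  · rintro ⟨a, rfl⟩
    rw [smul_eq_mul, mul_assoc, he]
  · intro h
    exact ⟨x, h⟩

theorem isIdempotentGenerator_right (he : e * e = e) :
    IsIdempotentGenerator (MulOpposite.op e)
      (⟨e, Submodule.mem_span_singleton_self e⟩ : rightPrincipal e) where
  smul_self := Subtype.ext he
  span_eq_top := by
    rw [eq_top_iff]
    rintro ⟨x, hx⟩ -
    obtain ⟨a, rfl⟩ := Submodule.mem_span_singleton.1 hx
    exact Submodule.mem_span_singleton.2 ⟨a, rfl⟩
  mul_eq_zero a ha := MulOpposite.unop_injective (congrArg Subtype.val ha)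

theorem isIdempotentGenerator_left (he : e * e = e) :
    IsIdempotentGenerator e (⟨e, Submodule.mem_span_singleton_self e⟩ : leftPrincipal e) where
  smul_self := Subtype.ext he
  span_eq_top := by
    rw [eq_top_iff]
    rintro ⟨x, hx⟩ -
    obtain ⟨a, rfl⟩ := Submodule.mem_span_singleton.1 hx
    exact Submodule.mem_span_singleton.2 ⟨a, rfl⟩
  mul_eq_zero a ha := congrArg Subtype.val ha

/-- Left multiplication by `a` as a map of right ideals. -/
def leftMulRestrict (P Q : Submodule Rᵐᵒᵖ R) (a : R) (h : ∀ x ∈ P, a * x ∈ Q) : P →ₗ[Rᵐᵒᵖ] Q where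
  toFun x := ⟨a * x.1, h x.1 x.2⟩
  map_add' x y := Subtype.ext (mul_add a x.1 y.1)
  map_smul' r x := Subtype.ext (mul_assoc a x.1 r.unop).symm

theorem nonempty_rightPrincipal_equiv_iff (he : e * e = e) (hf : f * f = f) :
    Nonempty (rightPrincipal e ≃ₗ[Rᵐᵒᵖ] rightPrincipal f) ↔ IdempotentsIso e f := by
  constructor
  · rintro ⟨E⟩
    -- A right linear map on `eR` is left multiplication by the image of `e`.
    have hE : ∀ x : rightPrincipal e,
        (E x).1 = (E ⟨e, Submodule.mem_span_singleton_self e⟩).1 * x.1 := fun x => by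
      have hx : x = MulOpposite.op x.1 •
          (⟨e, Submodule.mem_span_singleton_self e⟩ : rightPrincipal e) :=
        Subtype.ext ((mem_rightPrincipal he).1 x.2).symm
      conv_lhs => rw [hx, map_smul]
      rfl
    have hE' : ∀ x : rightPrincipal f,
        (E.symm x).1 = (E.symm ⟨f, Submodule.mem_span_singleton_self f⟩).1 * x.1 := fun x => by
      have hx : x = MulOpposite.op x.1 •
          (⟨f, Submodule.mem_span_singleton_self f⟩ : rightPrincipal f) :=
        Subtype.ext ((mem_rightPrincipal hf).1 x.2).symm
      conv_lhs => rw [hx, map_smul]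
      rfl
    set b := E ⟨e, Submodule.mem_span_singleton_self e⟩
    set a := E.symm ⟨f, Submodule.mem_span_singleton_self f⟩
    refine ⟨a, b, (mem_rightPrincipal he).1 a.2, ?_, (mem_rightPrincipal hf).1 b.2, ?_, ?_, ?_⟩
    · exact (hE' ⟨f, _⟩).symm
    · exact (hE ⟨e, _⟩).symm
    · rw [← hE', E.symm_apply_apply]
    · rw [← hE, E.apply_symm_apply]
  · rintro ⟨a, b, hea, haf, hfb, hbe, hab, hba⟩
    refine ⟨LinearEquiv.ofLinearMap
      (leftMulRestrict (rightPrincipal e) (rightPrincipal f) b fun x _ =>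
        (mem_rightPrincipal hf).2 (by rw [← mul_assoc, hfb]))
      (leftMulRestrict (rightPrincipal f) (rightPrincipal e) a fun x _ =>
        (mem_rightPrincipal he).2 (by rw [← mul_assoc, hea])) ?_ ?_⟩
    · ext x
      change b * (a * x.1) = x.1
      rw [← mul_assoc, hba, (mem_rightPrincipal hf).1 x.2]
    · ext x
      change a * (b * x.1) = x.1
      rw [← mul_assoc, hab, (mem_rightPrincipal he).1 x.2]

theorem mul_mem_rightSocle_left (r : R) {x : R} (hx : x ∈ rightSocle R) : r * x ∈ rightSocle R :=
  map_mem_moduleSocle (LinearMap.mulLeft Rᵐᵒᵖ r) hx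

theorem mul_mem_rightSocle_right (r : R) {x : R} (hx : x ∈ rightSocle R) : x * r ∈ rightSocle R :=
  (rightSocle R).smul_mem (MulOpposite.op r) hx

theorem mul_mem_leftSocle_left (r : R) {x : R} (hx : x ∈ leftSocle R) : r * x ∈ leftSocle R :=
  (leftSocle R).smul_mem r hx

theorem mul_mem_leftSocle_right (r : R) {x : R} (hx : x ∈ leftSocle R) : x * r ∈ leftSocle R :=
  map_mem_moduleSocle (LinearMap.mulRight R r) hx

theorem mem_rightSocle_of_mem_socle {x : rightPrincipal e}
    (hx : x ∈ moduleSocle Rᵐᵒᵖ (rightPrincipal e)) : x.1 ∈ rightSocle R :=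
  map_mem_moduleSocle (rightPrincipal e).subtype hx

theorem mem_leftSocle_of_mem_socle {x : leftPrincipal e}
    (hx : x ∈ moduleSocle R (leftPrincipal e)) : x.1 ∈ leftSocle R :=
  map_mem_moduleSocle (leftPrincipal e).subtype hx

theorem mem_socle_rightPrincipal (he : e * e = e) {x : R} (hx : x ∈ rightSocle R)
    (hex : e * x = x) :
    (⟨x, (mem_rightPrincipal he).2 hex⟩ : rightPrincipal e) ∈
      moduleSocle Rᵐᵒᵖ (rightPrincipal e) := by
  have := map_mem_moduleSocle ((LinearMap.mulLeft Rᵐᵒᵖ e).codRestrict (rightPrincipal e)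
    fun y => (mem_rightPrincipal he).2 (by simp [← mul_assoc, he])) hx
  convert this using 1
  exact Subtype.ext hex.symm

theorem mem_socle_leftPrincipal (he : e * e = e) {x : R} (hx : x ∈ leftSocle R)
    (hex : x * e = x) :
    (⟨x, (mem_leftPrincipal he).2 hex⟩ : leftPrincipal e) ∈ moduleSocle R (leftPrincipal e) := by
  have := map_mem_moduleSocle ((LinearMap.mulRight R e).codRestrict (leftPrincipal e)
    fun y => (mem_leftPrincipal he).2 (by simp [mul_assoc, he])) hx
  convert this using 1
  exact Subtype.ext hex.symm

theorem exists_mul_eq_of_isSimpleModule_right (he : e * e = e)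
    [IsSimpleModule Rᵐᵒᵖ (moduleSocle Rᵐᵒᵖ (rightPrincipal e))] {x y : R}
    (hx : x ∈ rightSocle R) (hex : e * x = x) (hx0 : x ≠ 0)
    (hy : y ∈ rightSocle R) (hey : e * y = y) : ∃ r, x * r = y := by
  obtain ⟨r, hr⟩ := IsSimpleModule.toSpanSingleton_surjective Rᵐᵒᵖ
    (m := (⟨_, mem_socle_rightPrincipal he hx hex⟩ : moduleSocle Rᵐᵒᵖ (rightPrincipal e)))
    (fun h => hx0 (congrArg (fun z => z.1.1) h)) ⟨_, mem_socle_rightPrincipal he hy hey⟩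
  exact ⟨r.unop, congrArg (fun z => z.1.1) hr⟩

theorem exists_mul_eq_of_isSimpleModule_left (he : e * e = e)
    [IsSimpleModule R (moduleSocle R (leftPrincipal e))] {x y : R}
    (hx : x ∈ leftSocle R) (hex : x * e = x) (hx0 : x ≠ 0)
    (hy : y ∈ leftSocle R) (hey : y * e = y) : ∃ r, r * x = y := by
  obtain ⟨r, hr⟩ := IsSimpleModule.toSpanSingleton_surjective R
    (m := (⟨_, mem_socle_leftPrincipal he hx hex⟩ : moduleSocle R (leftPrincipal e)))
    (fun h => hx0 (congrArg (fun z => z.1.1) h)) ⟨_, mem_socle_leftPrincipal he hy hey⟩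
  exact ⟨r, congrArg (fun z => z.1.1) hr⟩

end PrincipalIdeals

/-! ### Coincidence of the two socles -/

section Socles

variable {R : Type*} [Ring R]

theorem mul_mem_leftSocle_of_mem_rightSocle (hess : HasEssentialRightSocle R) {e : R}
    (he : e * e = e) [IsSimpleModule Rᵐᵒᵖ (moduleSocle Rᵐᵒᵖ (rightPrincipal e))]
    (hl : ∃ x ∈ leftSocle R, e * x ≠ 0) {y : R} (hy : y ∈ rightSocle R) :
    e * y ∈ leftSocle R := by
  obtain ⟨x, hx, hx0⟩ := hl
  have hne : rightPrincipal (e * x) ≠ ⊥ := fun h => hx0 (Submodule.span_singleton_eq_bot.1 h)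
  obtain ⟨z, ⟨hz, hz'⟩, hz0⟩ := Submodule.exists_mem_ne_zero_of_ne_bot (hess _ hne)
  obtain ⟨a, rfl⟩ := Submodule.mem_span_singleton.1 hz'
  obtain ⟨r, hr⟩ := exists_mul_eq_of_isSimpleModule_right he hz
    (by simp only [MulOpposite.smul_eq_mul_unop, ← mul_assoc, he]) hz0
    (mul_mem_rightSocle_left e hy) (by rw [← mul_assoc, he])
  rw [← hr]
  exact mul_mem_leftSocle_right _ (mul_mem_leftSocle_right _ (mul_mem_leftSocle_left _ hx))

theorem mul_mem_rightSocle_of_mem_leftSocle (hle : ∀ x ∈ rightSocle R, x ∈ leftSocle R) {e : R}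
    (he : e * e = e) [IsSimpleModule R (moduleSocle R (leftPrincipal e))]
    (hr : ∃ x ∈ rightSocle R, x * e ≠ 0) {y : R} (hy : y ∈ leftSocle R) :
    y * e ∈ rightSocle R := by
  obtain ⟨x, hx, hx0⟩ := hr
  obtain ⟨r, hr⟩ := exists_mul_eq_of_isSimpleModule_left he
    (mul_mem_leftSocle_right e (hle x hx)) (by rw [mul_assoc, he]) hx0
    (mul_mem_leftSocle_right e hy) (by rw [mul_assoc, he])
  rw [← hr]
  exact mul_mem_rightSocle_left _ (mul_mem_rightSocle_right _ hx)

/-- The socles coincide if the primitive one-sided ideals of a family of idempotents representing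
a complete one have simple socles and meet the socle of the other side. -/
theorem soclesCoincide_of_representatives (hess : HasEssentialRightSocle R) {m n : ℕ}
    {f : Fin m → R} {e : Fin n → R} (hf : CompleteOrthogonalIdempotents f)
    (he : ∀ k, e k * e k = e k) (hfe : ∀ i, ∃ k, IdempotentsIso (f i) (e k))
    (hsr : ∀ k, IsSimpleModule Rᵐᵒᵖ (moduleSocle Rᵐᵒᵖ (rightPrincipal (e k))))
    (hsl : ∀ k, IsSimpleModule R (moduleSocle R (leftPrincipal (e k))))
    (hl : ∀ k, ∃ x ∈ leftSocle R, e k * x ≠ 0)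
    (hr : ∀ k, ∃ x ∈ rightSocle R, x * e k ≠ 0) : SoclesCoincide R := by
  have hle : ∀ x ∈ rightSocle R, x ∈ leftSocle R := fun x hx => by
    rw [← one_mul x, ← hf.complete, Finset.sum_mul]
    refine sum_mem fun i _ => ?_
    obtain ⟨k, a, b, -, ha, hb, -, hab, -⟩ := hfe i
    have := hsr k
    -- The factorization `f i = a * b` with `b = e k * b` reduces `f i * x` to `e k * (b * x)`.
    have := mul_mem_leftSocle_of_mem_rightSocle hess (he k) (hl k) (mul_mem_rightSocle_left b hx)
    rw [← hab, mul_assoc]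
    rw [← mul_assoc, hb] at this
    exact mul_mem_leftSocle_left a this
  refine Set.Subset.antisymm (fun x hx => ?_) hle
  change x ∈ rightSocle R
  rw [← mul_one x, ← hf.complete, Finset.mul_sum]
  refine sum_mem fun i _ => ?_
  obtain ⟨k, a, b, -, ha, hb, -, hab, -⟩ := hfe i
  have := hsl k
  have := mul_mem_rightSocle_of_mem_leftSocle hle (he k) (hr k) (mul_mem_leftSocle_right a hx)
  rw [← hab, ← mul_assoc]
  rw [mul_assoc, ha] at this
  exact mul_mem_rightSocle_right b this

/-- The top of `eR` embeds in `R`, and the image of a vector fixed by `e` is the required element.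
-/
theorem IsRightKasch.exists_mul_ne_zero {R : Type*} [Ring R] (h : IsRightKasch R) {e : R}
    (he : CornerLocal e) : ∃ x ∈ rightSocle R, x * e ≠ 0 := by
  have hgen := isIdempotentGenerator_right he.2.1
  have hs := hgen.isSimpleModule_top he.op
  obtain ⟨v, hv, hev⟩ := hgen.exists_top he.op
  obtain ⟨I, ⟨E⟩⟩ := h _ hs
  refine ⟨(E v).1, mem_moduleSocle_of_equiv_simple E v, ?_⟩
  change (MulOpposite.op e • E v).1 ≠ 0
  rw [← map_smul, hev]
  simpa using hv

theorem IsLeftKasch.exists_mul_ne_zero {R : Type*} [Ring R] (h : IsLeftKasch R) {e : R}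
    (he : CornerLocal e) : ∃ x ∈ leftSocle R, e * x ≠ 0 := by
  have hgen := isIdempotentGenerator_left he.2.1
  have hs := hgen.isSimpleModule_top he
  obtain ⟨v, hv, hev⟩ := hgen.exists_top he
  obtain ⟨I, ⟨E⟩⟩ := h _ hs
  refine ⟨(E v).1, mem_moduleSocle_of_equiv_simple E v, ?_⟩
  change (e • E v).1 ≠ 0
  rw [← map_smul, hev]
  simpa using hv

theorem soclesCoincide_of_kasch (hR : IsSemiperfectRing R) (hess : HasEssentialRightSocle R)
    (hqr : IsRightQF2 R) (hql : IsLeftQF2 R) (hkr : IsRightKasch R) (hkl : IsLeftKasch R) :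
    SoclesCoincide R := by
  obtain ⟨m, f, hf⟩ := hR
  have hloc : ∀ i, CornerLocal (f i) := fun i => (hf.isLocal i).cornerLocal
  have hid : ∀ i, f i * f i = f i := fun i => (hloc i).2.1
  exact soclesCoincide_of_representatives hess hf.complete hid
    (fun i => ⟨i, f i, f i, hid i, hid i, hid i, hid i, hid i, hid i⟩)
    (fun i => hqr _ (hf.isLocal i)) (fun i => hql _ (hf.isLocal i))
    (fun i => hkl.exists_mul_ne_zero (hloc i)) (fun i => hkr.exists_mul_ne_zero (hloc i))

end Socles

/-! ### Basic sets and Nakayama permutations -/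

section Nakayama

variable {R : Type*} [Ring R] {n : ℕ} {e : Fin n → R}

theorem IsBasicSet.isLocalIdempotent (h : IsBasicSet e) (k : Fin n) :
    IsLocalIdempotent (e k) := by
  obtain ⟨m, f, ι, hf, hι, -⟩ := h
  rw [hι]
  exact hf.isLocal _

theorem IsBasicSet.exists_representatives (h : IsBasicSet e) :
    ∃ (m : ℕ) (f : Fin m → R), CompleteOrthogonalIdempotents f ∧
      ∀ i, ∃ k, IdempotentsIso (f i) (e k) := by
  have he := h.isLocalIdempotent
  obtain ⟨m, f, ι, hf, -, hu⟩ := h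
  refine ⟨m, f, hf.complete, fun i => ?_⟩
  obtain ⟨k, hk, -⟩ := hu i
  exact ⟨k, (nonempty_rightPrincipal_equiv_iff (hf.isLocal i).cornerLocal.2.1
    (he k).cornerLocal.2.1).1 hk⟩

theorem IsBasicSet.eq_of_idempotentsIso (h : IsBasicSet e) {j k : Fin n}
    (hjk : IdempotentsIso (e j) (e k)) : j = k := by
  have he := fun k => (h.isLocalIdempotent k).cornerLocal.2.1
  obtain ⟨m, f, ι, -, hι, hu⟩ := h
  have := hu (ι j)
  rw [← hι] at this
  exact this.unique ⟨LinearEquiv.refl _ _⟩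
    ((nonempty_rightPrincipal_equiv_iff (he j) (he k)).2 hjk)

theorem IsSemiperfectRing.exists_isBasicSet (hR : IsSemiperfectRing R) :
    ∃ (n : ℕ) (e : Fin n → R), IsBasicSet e := by
  classical
  obtain ⟨m, f, hf⟩ := hR
  let s : Setoid (Fin m) :=
    { r := fun i j => Nonempty (rightPrincipal (f i) ≃ₗ[Rᵐᵒᵖ] rightPrincipal (f j))
      iseqv := ⟨fun _ => ⟨LinearEquiv.refl _ _⟩, fun ⟨E⟩ => ⟨E.symm⟩,
        fun ⟨E⟩ ⟨E'⟩ => ⟨E.trans E'⟩⟩ }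
  let q := Fintype.equivFin (Quotient s)
  have hout : ∀ k, Quotient.mk s (q.symm k).out = q.symm k := fun k => Quotient.out_eq _
  let ι : Fin (Fintype.card (Quotient s)) ↪ Fin m :=
    ⟨fun k => (q.symm k).out, fun j k h => q.symm.injective (by
      rw [← hout j, ← hout k]; exact congrArg _ h)⟩
  refine ⟨_, fun k => f (ι k), m, f, ι, hf, fun _ => rfl, fun i => ?_⟩
  refine ⟨q (Quotient.mk s i), ?_, fun k hk => ?_⟩
  · have : Quotient.mk s i = Quotient.mk s (ι (q (Quotient.mk s i))) := by
      change _ = Quotient.mk s (q.symm _).out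
      rw [hout, q.symm_apply_apply]
    exact Quotient.exact this
  · have : Quotient.mk s i = Quotient.mk s (ι k) := Quotient.sound hk
    rw [this]
    change k = q (Quotient.mk s (q.symm k).out)
    rw [hout, q.apply_symm_apply]

/-- If the right socle is essential, a Nakayama permutation forces the socles to coincide. -/
theorem IsNakayamaPermutation.soclesCoincide (hess : HasEssentialRightSocle R)
    (he : IsBasicSet e) {π : Equiv.Perm (Fin n)} (hπ : IsNakayamaPermutation e π) :
    SoclesCoincide R := by
  have hloc := fun k => (he.isLocalIdempotent k).cornerLocal
  have hid := fun k => (hloc k).2.1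
  obtain ⟨m, f, hf, hfe⟩ := he.exists_representatives
  refine soclesCoincide_of_representatives hess hf hid hfe (fun k => ?_) (fun k => ?_)
    (fun k => ?_) (fun k => ?_)
  · obtain ⟨E⟩ := hπ.right k
    have := (isIdempotentGenerator_right (hid (π k))).isSimpleModule_top (hloc _).op
    exact IsSimpleModule.congr E
  -- The left isomorphisms describe the socles at indices `π j`, and every index has this form.
  · obtain ⟨j, rfl⟩ := π.surjective k
    obtain ⟨E⟩ := hπ.left j
    have := (isIdempotentGenerator_left (hid j)).isSimpleModule_top (hloc _)
    exact IsSimpleModule.congr E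
  · obtain ⟨E⟩ := hπ.left k
    obtain ⟨v, hv, hev⟩ := (isIdempotentGenerator_left (hid k)).exists_top (hloc _)
    refine ⟨(E.symm v).1.1, mem_leftSocle_of_mem_socle (E.symm v).2, ?_⟩
    change (e k • E.symm v).1.1 ≠ 0
    rw [← map_smul, hev]
    simpa using hv
  · obtain ⟨j, rfl⟩ := π.surjective k
    obtain ⟨E⟩ := hπ.right j
    obtain ⟨v, hv, hev⟩ := (isIdempotentGenerator_right (hid (π j))).exists_top (hloc _).op
    refine ⟨(E.symm v).1.1, mem_rightSocle_of_mem_socle (E.symm v).2, ?_⟩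
    change (MulOpposite.op (e (π j)) • E.symm v).1.1 ≠ 0
    rw [← map_smul, hev]
    simpa using hv

theorem SoclesCoincide.exists_isNakayamaPermutation (hS : SoclesCoincide R)
    (hqr : IsRightQF2 R) (hql : IsLeftQF2 R) (he : IsBasicSet e) :
    ∃ π : Equiv.Perm (Fin n), IsNakayamaPermutation e π := by
  have hmem : ∀ x, x ∈ rightSocle R → x ∈ leftSocle R := fun x hx => hS.symm.subset hx
  have hloc := fun k => (he.isLocalIdempotent k).cornerLocal
  have hid := fun k => (hloc k).2.1
  have hsr := fun k => hqr _ (he.isLocalIdempotent k)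
  have hsl := fun k => hql _ (he.isLocalIdempotent k)
  obtain ⟨m, f, hf, hfe⟩ := he.exists_representatives
  have hex : ∀ k, ∃ j, ∃ x ∈ rightSocle R, x ≠ 0 ∧ e k * x = x ∧ x * e j = x := fun k => by
    have := (hsr k).nontrivial
    obtain ⟨⟨⟨x, hx⟩, hxs⟩, hx0⟩ := exists_ne (0 : moduleSocle Rᵐᵒᵖ (rightPrincipal (e k)))
    have hx0 : x ≠ 0 := fun h => hx0 (Subtype.ext (Subtype.ext h))
    obtain ⟨i, hi⟩ : ∃ i, x * f i ≠ 0 := by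
      by_contra! h
      exact hx0 (by rw [← mul_one x, ← hf.complete, Finset.mul_sum]; simp [h])
    -- `f i` may lie outside the basic set; right multiplication by `a` moves `x` into `R e_j`, and
    -- it stays nonzero since `x * a * b = x * f i`.
    obtain ⟨j, a, b, -, ha, -, -, hab, -⟩ := hfe i
    refine ⟨j, x * a, mul_mem_rightSocle_right a (mem_rightSocle_of_mem_socle hxs),
      fun h => hi ?_, ?_, ?_⟩
    · rw [← hab, ← mul_assoc, h, zero_mul]
    · rw [← mul_assoc, (mem_rightPrincipal (hid k)).1 hx]
    · rw [mul_assoc, ha]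
  choose p x hx hx0 hex hxe using hex
  -- If `p j = p k`, then `e j` and `e k` both act nontrivially on the same simple left socle, so
  -- they are isomorphic.
  have hinj : Function.Injective p := fun j k hjk => by
    have := hsl (p k)
    refine he.eq_of_idempotentsIso ((hloc j).idempotentsIso (hloc k)
      (V := moduleSocle R (leftPrincipal (e (p k))))
      (v := ⟨_, mem_socle_leftPrincipal (hid _) (hmem _ (hx j)) (hjk ▸ hxe j)⟩)
      (w := ⟨_, mem_socle_leftPrincipal (hid _) (hmem _ (hx k)) (hxe k)⟩)
      (fun h => hx0 j (congrArg (fun z => z.1.1) h))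
      (fun h => hx0 k (congrArg (fun z => z.1.1) h))
      (Subtype.ext (Subtype.ext (hex j))) (Subtype.ext (Subtype.ext (hex k))))
  refine ⟨Equiv.ofBijective p (Finite.injective_iff_bijective.1 hinj), fun k => ?_, fun k => ?_⟩
  · have := hsr k
    exact (isIdempotentGenerator_right (hid (p k))).nonempty_equiv_top (hloc _).op
      (v := (⟨_, mem_socle_rightPrincipal (hid _) (hx k) (hex k)⟩ :
        moduleSocle Rᵐᵒᵖ (rightPrincipal (e k))))
      (fun h => hx0 k (congrArg (fun z => z.1.1) h)) (Subtype.ext (Subtype.ext (hxe k)))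
  · have := hsl (p k)
    exact (isIdempotentGenerator_left (hid k)).nonempty_equiv_top (hloc _)
      (v := (⟨_, mem_socle_leftPrincipal (hid _) (hmem _ (hx k)) (hxe k)⟩ :
        moduleSocle R (leftPrincipal (e (p k)))))
      (fun h => hx0 k (congrArg (fun z => z.1.1) h)) (Subtype.ext (Subtype.ext (hex k)))

end Nakayama

theorem mainTheorem3 {R : Type*} [Ring R] (hR : IsSemiperfectRing R)
    (hess : HasEssentialRightSocle R) :
    (IsRightQF2 R → IsLeftQF2 R → IsRightKasch R → IsLeftKasch R →
      SoclesCoincide R ∧ HasNakayamaPermutation R ∧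
        ∀ (n : ℕ) (e : Fin n → R), IsBasicSet e →
          ∃ π : Equiv.Perm (Fin n), IsNakayamaPermutation e π) ∧
    (HasNakayamaPermutation R → SoclesCoincide R) := by
  refine ⟨fun hqr hql hkr hkl => ?_, fun ⟨n, e, π, he, hπ⟩ => hπ.soclesCoincide hess he⟩
  have hS := soclesCoincide_of_kasch hR hess hqr hql hkr hkl
  obtain ⟨n, e, he⟩ := hR.exists_isBasicSet
  obtain ⟨π, hπ⟩ := hS.exists_isNakayamaPermutation hqr hql he
  exact ⟨hS, ⟨n, e, π, he, hπ⟩, fun _ _ he => hS.exists_isNakayamaPermutation hqr hql he⟩
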